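/- Let $\Bbbk$ be an algebraically closed field of characteristic zero, let $\mathbb S_3$ be the symmetric group on three letters and $\mathcal O$ the set of its transpositions. Let $\mathcal A_1$ be the $\Bbbk$-algebra with generators $H_t$ ($t\in\mathbb S_3$) and $a_i$ ($i\in\mathcal O$) and relations \begin{align*} &H_e=1,\qquad H_tH_s=H_{ts} && (t,s\in\mathbb S_3),\\ &H_t a_i=\operatorname{sgn}(t)\,a_{tit^{-1}}H_t && (t\in\mathbb S_3,\ i\in\mathcal O),\\ &a_i^2=0 && (i\in\mathcal O),\\ &a_ia_j+a_{iji^{-1}}a_i+a_ja_{iji^{-1}}=1-H_{ij} && (i\ne j\in\mathcal O). \end{align*} Let $W_\epsilon$, $W_{\mathrm{sg}}$ and $W_{\mathrm{st}}$ be the trivial, the sign and the two-dimensional standard representation of $\mathbb S_3$ over $\Bbbk$. For $\chi\in\{\epsilon,\mathrm{sg}\}$ let $S_\chi$ be the one-dimensional $\mathcal A_1$-module on which $H_t$ acts by $\chi(t)$ and every $a_i$ acts by $0$, and let $I_\chi=\mathcal A_1\otimes_{\Bbbk\mathbb S_3}W_\chi$, where $\Bbbk\mathbb S_3$ acts on $\mathcal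 A_1$ from the right through $t\mapsto H_t$. Then, for each $\chi\in\{\epsilon,\mathrm{sg}\}$: \begin{enumerate} \item $I_\chi$ is an indecomposable $\mathcal A_1$-module, that is, it is nonzero and not the direct sum of two nonzero submodules. \item $I_\chi$ is the projective cover of $S_\chi$: $I_\chi$ is a projective $\mathcal A_1$-module, and the map $\pi\colon I_\chi\to S_\chi$, $\pi(h\otimes w)=h\cdot w$ (identifying the vector spaces $W_\chi$ and $S_\chi$ with $\Bbbk$) is a well-defined surjective $\mathcal A_1$-linear map such that $\pi(N)\ne S_\chi$ for every proper submodule $N\subsetneq I_\chi$. \item $\dim_{\Bbbk}I_\chi=12$. \item As a representation of $\mathbb S_3$ (through $t\mapsto H_t$), $I_\chi\cong W_\epsilon^{\oplus2}\oplus W_{\mathrm{sg}}^{\oplus2}\oplus W_{\mathrm{st}}^{\oplus4}$. \end{enumerate} -/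

import Mathlib

open scoped TensorProduct

noncomputable section

namespace PointedS3

/-- The symmetric group on three letters; the letters `1, 2, 3` are `0, 1, 2 : Fin 3`. -/
abbrev S3 : Type := Equiv.Perm (Fin 3)

/-- The rack of transpositions in `S3`. -/
abbrev Transp : Type := {τ : S3 // τ.IsSwap}

theorem isSwap_conj (t : S3) {τ : S3} (h : τ.IsSwap) : (t * τ * t⁻¹).IsSwap := by
  obtain ⟨x, y, hxy, rfl⟩ := h
  exact ⟨t x, t y, fun e => hxy (t.injective e), by
    rw [Equiv.swap_apply_apply]⟩

/-- The action of `S3` on the transpositions by conjugation. -/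
def Transp.conj (t : S3) (i : Transp) : Transp := ⟨t * i.1 * t⁻¹, isSwap_conj t i.2⟩

/-- Generators of the algebra `𝒜_lam`: `H_t` for `t ∈ S3`, and `a_i` for `i` a transposition. -/
inductive Gen : Type
  | H (t : S3)
  | a (i : Transp)

section Algebra

variable (k : Type*) [Field k]

/-- `H_t` in the free algebra. -/
def freeH (t : S3) : FreeAlgebra k Gen := FreeAlgebra.ι k (Gen.H t)

/-- `a_i` in the free algebra. -/
def freeA (i : Transp) : FreeAlgebra k Gen := FreeAlgebra.ι k (Gen.a i)

/-- The defining relations of `𝒜_lam`. -/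
inductive Rel (lam : k) : FreeAlgebra k Gen → FreeAlgebra k Gen → Prop
  | H_one : Rel lam (freeH k 1) 1
  | H_mul (t s : S3) : Rel lam (freeH k t * freeH k s) (freeH k (t * s))
  | H_a (t : S3) (i : Transp) :
      Rel lam (freeH k t * freeA k i)
        (((Equiv.Perm.sign t : ℤ) : k) • (freeA k (Transp.conj t i) * freeH k t))
  | a_sq (i : Transp) : Rel lam (freeA k i * freeA k i) 0
  | a_quad (i j : Transp) (hij : i ≠ j) :
      Rel lam
        (freeA k i * freeA k j + freeA k (Transp.conj i.1 j) * freeA k i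
          + freeA k j * freeA k (Transp.conj i.1 j))
        (lam • (1 - freeH k (i.1 * j.1)))

/-- The algebra `𝒜_lam`, given by generators and relations. -/
def Alg (lam : k) : Type _ := RingQuot (Rel k lam)

instance (lam : k) : Ring (Alg k lam) := inferInstanceAs (Ring (RingQuot (Rel k lam)))

instance (lam : k) : Algebra k (Alg k lam) :=
  inferInstanceAs (Algebra k (RingQuot (Rel k lam)))

/-- The quotient map from the free algebra. -/
def Alg.mk (lam : k) : FreeAlgebra k Gen →ₐ[k] Alg k lam := RingQuot.mkAlgHom k (Rel k lam)

/-- The group homomorphism `t ↦ H_t` from `S3` to `𝒜_lam`. -/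
def Alg.H (lam : k) : S3 →* Alg k lam where
  toFun t := Alg.mk k lam (freeH k t)
  map_one' := (RingQuot.mkAlgHom_rel k (Rel.H_one (lam := lam))).trans (map_one (Alg.mk k lam))
  map_mul' t s :=
    ((map_mul (Alg.mk k lam) _ _).symm.trans
      (RingQuot.mkAlgHom_rel k (Rel.H_mul (lam := lam) t s))).symm

/-- The generator `a_i` of `𝒜_lam`. -/
def Alg.a (lam : k) (i : Transp) : Alg k lam := Alg.mk k lam (freeA k i)

end Algebra

section Characters

variable {k : Type*} [Field k]

variable (k) in
/-- The sign character of `S3`. -/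
def sgChar : S3 →* kˣ := (Units.map (Int.castRingHom k).toMonoidHom).comp Equiv.Perm.sign

/-- The one-dimensional representation `W_χ` of `S3`. -/
def charRep (χ : S3 →* kˣ) : Representation k S3 k where
  toFun t := (χ t : k) • LinearMap.id
  map_one' := by ext; simp
  map_mul' t s := by ext; simp [mul_comm]

theorem char_transp_mul (χ : S3 →* kˣ) (i j : Transp) : χ (i.1 * j.1) = 1 := by
  obtain ⟨_, x, y, hxy, rfl⟩ := i
  obtain ⟨_, z, w, hzw, rfl⟩ := j
  obtain ⟨c, hc⟩ := isConj_iff.1 (Equiv.Perm.isConj_swap hxy hzw)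
  have h : χ (Equiv.swap z w) = χ (Equiv.swap x y) := by
    rw [← hc, map_mul, map_mul, map_inv, mul_comm, inv_mul_cancel_left]
  rw [map_mul, h, ← map_mul, Equiv.swap_mul_self, map_one]

/-- The values on generators of the character of `𝒜_lam` extending `χ`: it sends `H_t` to `χ t`
and every `a_i` to `0`. -/
def genValue (χ : S3 →* kˣ) : Gen → k
  | Gen.H t => (χ t : k)
  | Gen.a _ => 0

/-- The algebra map `𝒜_lam → k` with `H_t ↦ χ t` and `a_i ↦ 0`. -/
def Alg.char (lam : k) (χ : S3 →* kˣ) : Alg k lam →ₐ[k] k :=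
  RingQuot.liftAlgHom k ⟨FreeAlgebra.lift k (genValue χ), by
    intro x y h
    cases h <;> simp [freeH, freeA, genValue, char_transp_mul]⟩

theorem Alg.char_H (lam : k) (χ : S3 →* kˣ) (t : S3) :
    Alg.char lam χ (Alg.H k lam t) = (χ t : k) := by
  change RingQuot.liftAlgHom k _ (RingQuot.mkAlgHom k _ _) = _
  rw [RingQuot.liftAlgHom_mkAlgHom_apply]
  simp [freeH, genValue]

theorem Alg.char_a (lam : k) (χ : S3 →* kˣ) (i : Transp) :
    Alg.char lam χ (Alg.a k lam i) = 0 := by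
  change RingQuot.liftAlgHom k _ (RingQuot.mkAlgHom k _ _) = _
  rw [RingQuot.liftAlgHom_mkAlgHom_apply]
  simp [freeA, genValue]

/-- The one-dimensional `𝒜_lam`-module `S_χ`: `H_t` acts by `χ t`, and every `a_i` acts by `0`. -/
def SimpleChar (_lam : k) (_χ : S3 →* kˣ) : Type _ := k

instance (lam : k) (χ : S3 →* kˣ) : AddCommGroup (SimpleChar lam χ) :=
  inferInstanceAs (AddCommGroup k)

instance (lam : k) (χ : S3 →* kˣ) : Module k (SimpleChar lam χ) :=
  inferInstanceAs (Module k k)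

instance (lam : k) (χ : S3 →* kˣ) : Module (Alg k lam) (SimpleChar lam χ) :=
  Module.compHom k (Alg.char lam χ).toRingHom

/-- The identification of the space underlying `W_χ` with the one underlying `S_χ`. -/
def SimpleChar.of (lam : k) (χ : S3 →* kˣ) : k ≃ₗ[k] SimpleChar lam χ := LinearEquiv.refl k k

theorem SimpleChar.smul_of (lam : k) (χ : S3 →* kˣ) (h : Alg k lam) (c : k) :
    h • SimpleChar.of lam χ c = SimpleChar.of lam χ (Alg.char lam χ h * c) := rfl

end Characters

section Standard

variable (k : Type*) [CommRing k]

/-- The matrix of `t` in the basis `v = e₁ - e₃`, `w = e₂ - e₃` of the standard representation. -/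
def stMatrix (t : S3) : Matrix (Fin 2) (Fin 2) k := fun i j =>
  (if t j.castSucc = i.castSucc then 1 else 0) - (if t 2 = i.castSucc then 1 else 0)

theorem stMatrix_swap01 : stMatrix k (Equiv.swap 0 1) = !![0, 1; 1, 0] := by
  ext i j; fin_cases i <;> fin_cases j <;> simp [stMatrix, Equiv.swap_apply_def]

theorem stMatrix_swap12 : stMatrix k (Equiv.swap 1 2) = !![1, 0; -1, -1] := by
  ext i j; fin_cases i <;> fin_cases j <;> simp [stMatrix, Equiv.swap_apply_def]

theorem stMatrix_swap02 : stMatrix k (Equiv.swap 0 2) = !![-1, -1; 0, 1] := by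
  ext i j; fin_cases i <;> fin_cases j <;> simp [stMatrix, Equiv.swap_apply_def]

theorem stMatrix_one : stMatrix k 1 = 1 := by
  ext i j; fin_cases i <;> fin_cases j <;> simp [stMatrix]

theorem stMatrix_int_mul :
    ∀ t s : S3, stMatrix ℤ (t * s) = stMatrix ℤ t * stMatrix ℤ s := by
  decide +kernel

theorem stMatrix_map (t : S3) : (stMatrix ℤ t).map (Int.castRingHom k) = stMatrix k t := by
  ext i j
  simp only [Matrix.map_apply, stMatrix, map_sub]
  congr 1 <;> split_ifs <;> simp

theorem stMatrix_mul (t s : S3) : stMatrix k (t * s) = stMatrix k t * stMatrix k s := by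
  rw [← stMatrix_map, stMatrix_int_mul, Matrix.map_mul, stMatrix_map, stMatrix_map]

/-- The standard two-dimensional representation `W_st` of `S3`. -/
def stRep : Representation k S3 (Fin 2 → k) where
  toFun t := Matrix.toLin' (stMatrix k t)
  map_one' := by rw [stMatrix_one, Matrix.toLin'_one]; rfl
  map_mul' t s := by rw [stMatrix_mul, Matrix.toLin'_mul]; rfl

end Standard

section Induction

variable {k G A W M : Type*} [Field k] [Group G] [Ring A] [Algebra k A]
  [AddCommGroup W] [Module k W] [AddCommGroup M] [Module k M] [Module A M] [IsScalarTower k A M]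

/-- The relations `h φ(g) ⊗ w = h ⊗ g w` of the tensor product over the group algebra. -/
def indRel (φ : G →* A) (ρ : Representation k G W) : Submodule A (A ⊗[k] W) :=
  Submodule.span A
    {z | ∃ (h : A) (g : G) (w : W), z = (h * φ g) ⊗ₜ[k] w - h ⊗ₜ[k] (ρ g w)}

/-- The induced module `A ⊗_{kG} W`, where `A` is a right `kG`-module through `φ : G → A`. -/
abbrev Ind (φ : G →* A) (ρ : Representation k G W) : Type _ := (A ⊗[k] W) ⧸ indRel φ ρ

/-- The class of the pure tensor `h ⊗ w` in the induced module. -/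
def Ind.tmul (φ : G →* A) (ρ : Representation k G W) (h : A) (w : W) : Ind φ ρ :=
  (indRel φ ρ).mkQ (h ⊗ₜ[k] w)

variable (k M) in
/-- Restriction of an `A`-module to a representation of `G` through `φ : G → A`. -/
def resRep (φ : G →* A) : Representation k G M :=
  ((Algebra.lsmul k k M : A →ₐ[k] Module.End k M) : A →* Module.End k M).comp φ

end Induction

section Modules

variable {A P M : Type*} [Ring A] [AddCommGroup P] [Module A P] [AddCommGroup M] [Module A M]

variable (A M) in
/-- A nonzero module that is not the direct sum of two nonzero submodules. -/
def IsIndecomposableModule : Prop :=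
  Nontrivial M ∧ ∀ U V : Submodule A M, IsCompl U V → U = ⊥ ∨ V = ⊥

/-- `f : P → M` is a projective cover: `P` is projective and `f` is an essential map, that is,
`f` is surjective and no proper submodule of `P` is mapped onto `M`. -/
def IsProjectiveCover (f : P →ₗ[A] M) : Prop :=
  Module.Projective A P ∧ Function.Surjective f ∧
    ∀ N : Submodule A P, N ≠ ⊤ → N.map f ≠ ⊤

end Modules

/-- The induced module `I_χ = 𝒜_lam ⊗_{k S3} W_χ`. -/
abbrev IndChar {k : Type*} [Field k] (lam : k) (χ : S3 →* kˣ) : Type _ :=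
  Ind (Alg.H k lam) (charRep χ)

end PointedS3

end

/-! Write `a, b, c` for the generators at (01), (12), (02) and `v` for the vector 1⊗1 of I_χ. The
quadratic relations push `c` to the right, and `a² = b² = 0` together with the deformed braid
relation `genA_braid` leaves six words in `a` and `b`. Hence twelve words, each possibly ending in
`c`, span I_χ. Explicit 12×12 integer matrices satisfy the defining relations, and in the module
they define the words applied to the first basis vector form the standard basis. So I_χ is this
model (`toModel_bijective`) and has dimension 12.

Since 6 is invertible, the idempotent of χ makes I_χ a direct summand of the algebra, hence
projective. The χ-isotypic part of I_χ is spanned by `v` and `z v` with `z = abac - ac`, and `z² v =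
0`. By Frobenius reciprocity the endomorphism ring is k[z]/(z²), which is local. Concretely, a
submodule that maps onto S_χ contains some `6v + d z v`; applying `6 - d z` gives `36 v`, so the
submodule is everything (`coverMap_essential`). An essential extension of a simple module is
indecomposable.

The decomposition over S3 is read off from explicit vectors of the model. Passing from ε to sg
tensors with the sign, which exchanges W_ε and W_sg and fixes W_st. -/

open scoped TensorProduct

noncomputable section

namespace PointedS3

/-! ### Integer matrices of the generators -/

section Tables

/-- The matrix of `a_(01)` on the words `1, a, b, c, ab, bc, ba, ac, aba, abc, bac, abac`,
where `a = a_(01)`, `b = a_(12)` and `c = a_(02)`. -/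
def aTable₀₁ : Matrix (Fin 12) (Fin 12) ℤ :=
  !![0, 0, 0, 0, 0, 0, 0, 0, 0, 0, 0, 0;
    1, 0, 0, 0, 0, 0, 0, 0, 0, 0, 0, 0;
    0, 0, 0, 0, 0, 0, 0, 0, 0, 0, 0, 0;
    0, 0, 0, 0, 0, 0, 0, 0, 0, 0, 0, 0;
    0, 0, 1, 0, 0, 0, 0, 0, 0, 0, 0, 0;
    0, 0, 0, 0, 0, 0, 0, 0, 0, 0, 0, 0;
    0, 0, 0, 0, 0, 0, 0, 0, 0, 0, 0, 0;
    0, 0, 0, 1, 0, 0, 0, 0, 0, 0, 0, 0;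
    0, 0, 0, 0, 0, 0, 1, 0, 0, 0, 0, 0;
    0, 0, 0, 0, 0, 1, 0, 0, 0, 0, 0, 0;
    0, 0, 0, 0, 0, 0, 0, 0, 0, 0, 0, 0;
    0, 0, 0, 0, 0, 0, 0, 0, 0, 0, 1, 0]

/-- The matrix of `a_(12)` on the words. -/
def aTable₁₂ : Matrix (Fin 12) (Fin 12) ℤ :=
  !![0, 0, 0, 0, 0, 0, 0, 0, 0, 0, 0, 0;
    0, 0, 0, 0, -1, 0, 0, 0, 0, 0, 0, 0;
    1, 0, 0, 0, 1, 0, 0, 0, 0, 0, 0, 0;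
    0, 0, 0, 0, 0, 0, 0, 0, 0, 0, 0, 0;
    0, 0, 0, 0, 0, 0, 0, 0, 0, 0, 0, 0;
    0, 0, 0, 1, 0, 0, 0, 0, 0, 1, 0, 0;
    0, 1, 0, 0, 0, 0, 0, 0, 1, 0, 0, 0;
    0, 0, 0, 0, 0, 0, 0, 0, 0, -1, 0, 0;
    0, 0, 0, 0, 1, 0, 0, 0, 0, 0, 0, 0;
    0, 0, 0, 0, 0, 0, 0, 0, 0, 0, 0, 0;
    0, 0, 0, 0, 0, 0, 0, 1, 0, 0, 0, 1;
    0, 0, 0, 0, 0, 0, 0, 0, 0, 1, 0, 0]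

/-- The matrix of `a_(02)` on the words. -/
def aTable₀₂ : Matrix (Fin 12) (Fin 12) ℤ :=
  !![0, 0, 0, 0, 0, 0, 0, 0, 0, 0, 0, 0;
    0, 0, 0, 0, 0, 0, 1, -1, 0, 0, 0, -1;
    0, 0, 0, 0, 1, -1, 0, 0, 0, 0, 0, 0;
    1, 0, 0, 0, -1, 1, -1, 1, 0, 0, 0, 1;
    0, -1, 0, 0, 0, 0, 0, 0, 0, 1, 0, 0;
    0, -1, 0, 0, 0, 0, 0, 0, 0, 1, 0, 0;
    0, 0, -1, 0, 0, 0, 0, 0, 1, 0, 1, 0;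
    0, 0, -1, 0, 0, 0, 0, 0, 2, 0, 1, 0;
    0, 0, 0, 0, 0, 0, 0, 0, 0, 0, 0, 0;
    0, 0, 0, 0, 0, 0, 1, -1, 0, 0, 0, -1;
    0, 0, 0, 0, 1, -1, 0, 0, 0, 0, 0, 0;
    0, 0, 0, 0, 0, 0, 0, 0, -1, 0, 0, 0]

/-- The matrix of `H_(01)` on the words. -/
def hTable₀₁ : Matrix (Fin 12) (Fin 12) ℤ :=
  !![1, 0, 0, 0, 0, 0, 0, 0, 0, 0, 0, 0;
    0, -1, 0, 0, 0, 0, 0, 0, 0, 0, 0, 0;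
    0, 0, 0, -1, 0, 0, 0, 0, 0, 0, -1, 0;
    0, 0, -1, 0, 0, 0, 0, 0, 0, 0, 1, 0;
    0, 0, 0, 0, 0, 0, -1, 1, 0, 0, 0, 1;
    0, 0, 0, 0, 0, 0, -1, 0, 0, 0, 0, 0;
    0, 0, 0, 0, 0, -1, 0, 0, 0, 0, 0, 0;
    0, 0, 0, 0, 1, -1, 0, 0, 0, 0, 0, -1;
    0, 0, 0, 0, 0, 0, 0, 0, 0, 1, 0, 0;
    0, 0, 0, 0, 0, 0, 0, 0, 1, 0, 0, 0;
    0, 0, 0, 0, 0, 0, 0, 0, 0, 0, -1, 0;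
    0, 0, 0, 0, 0, 0, 0, 0, 0, 0, 0, 1]

/-- The matrix of `H_(12)` on the words. -/
def hTable₁₂ : Matrix (Fin 12) (Fin 12) ℤ :=
  !![1, 0, 0, 0, 0, 0, 0, 0, 0, 0, 0, 0;
    0, 0, 0, -1, 0, 0, 0, 0, 0, -1, -1, 0;
    0, 0, -1, 0, 0, 0, 0, 0, 1, 0, 1, 0;
    0, -1, 0, 0, 0, 0, 0, 0, -1, 1, 0, 0;
    0, 0, 0, 0, 0, 0, 0, -1, 0, 0, 0, -1;
    0, 0, 0, 0, 0, 0, 1, -1, 0, 0, 0, -1;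
    0, 0, 0, 0, -1, 1, 0, 0, 0, 0, 0, 0;
    0, 0, 0, 0, -1, 0, 0, 0, 0, 0, 0, -1;
    0, 0, 0, 0, 0, 0, 0, 0, 0, 0, 1, 0;
    0, 0, 0, 0, 0, 0, 0, 0, 0, -1, 0, 0;
    0, 0, 0, 0, 0, 0, 0, 0, 1, 0, 0, 0;
    0, 0, 0, 0, 0, 0, 0, 0, 0, 0, 0, 1]

/-- The matrix of `H_(02)` on the words. -/
def hTable₀₂ : Matrix (Fin 12) (Fin 12) ℤ :=
  !![1, 0, 0, 0, 0, 0, 0, 0, 0, 0, 0, 0;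
    0, 0, -1, 0, 0, 0, 0, 0, 1, 0, 0, 0;
    0, -1, 0, 0, 0, 0, 0, 0, -1, 0, 0, 0;
    0, 0, 0, -1, 0, 0, 0, 0, 0, 0, 0, 0;
    0, 0, 0, 0, 0, 0, 1, 0, 0, 0, 0, 0;
    0, 0, 0, 0, 0, 0, 0, 1, 0, 0, 0, 1;
    0, 0, 0, 0, 1, 0, 0, 0, 0, 0, 0, 0;
    0, 0, 0, 0, 0, 1, 0, 0, 0, 0, 0, -1;
    0, 0, 0, 0, 0, 0, 0, 0, -1, 0, 0, 0;
    0, 0, 0, 0, 0, 0, 0, 0, 0, 0, -1, 0;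
    0, 0, 0, 0, 0, 0, 0, 0, 0, -1, 0, 0;
    0, 0, 0, 0, 0, 0, 0, 0, 0, 0, 0, 1]

/-- The matrix of `H_t`, `t = (01)(12)`, on the words. -/
def hTableRot : Matrix (Fin 12) (Fin 12) ℤ :=
  !![1, 0, 0, 0, 0, 0, 0, 0, 0, 0, 0, 0;
    0, 0, 0, 1, 0, 0, 0, 0, 0, 1, 1, 0;
    0, 1, 0, 0, 0, 0, 0, 0, 0, -1, 0, 0;
    0, 0, 1, 0, 0, 0, 0, 0, 0, 0, -1, 0;
    0, 0, 0, 0, 0, -1, 0, 0, 0, 0, 0, 0;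
    0, 0, 0, 0, 1, -1, 0, 0, 0, 0, 0, 0;
    0, 0, 0, 0, 0, 0, -1, 1, 0, 0, 0, 1;
    0, 0, 0, 0, 0, 0, -1, 0, 0, 0, 0, -1;
    0, 0, 0, 0, 0, 0, 0, 0, 0, -1, 0, 0;
    0, 0, 0, 0, 0, 0, 0, 0, 0, 0, 1, 0;
    0, 0, 0, 0, 0, 0, 0, 0, -1, 0, 0, 0;
    0, 0, 0, 0, 0, 0, 0, 0, 0, 0, 0, 1]

/-- The matrix of `H_t`, `t = (12)(01)`, on the words. -/
def hTableRotInv : Matrix (Fin 12) (Fin 12) ℤ :=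
  !![1, 0, 0, 0, 0, 0, 0, 0, 0, 0, 0, 0;
    0, 0, 1, 0, 0, 0, 0, 0, -1, 0, 0, 0;
    0, 0, 0, 1, 0, 0, 0, 0, 0, 1, 0, 0;
    0, 1, 0, 0, 0, 0, 0, 0, 1, -1, 0, 0;
    0, 0, 0, 0, -1, 1, 0, 0, 0, 0, 0, 0;
    0, 0, 0, 0, -1, 0, 0, 0, 0, 0, 0, 0;
    0, 0, 0, 0, 0, 0, 0, -1, 0, 0, 0, -1;
    0, 0, 0, 0, 0, 0, 1, -1, 0, 0, 0, -2;
    0, 0, 0, 0, 0, 0, 0, 0, 0, 0, -1, 0;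
    0, 0, 0, 0, 0, 0, 0, 0, -1, 0, 0, 0;
    0, 0, 0, 0, 0, 0, 0, 0, 0, 1, 0, 0;
    0, 0, 0, 0, 0, 0, 0, 0, 0, 0, 0, 1]

/-- The transpositions `(01)`, `(12)`, `(02)`. -/
def transp : Fin 3 → S3 := ![Equiv.swap 0 1, Equiv.swap 1 2, Equiv.swap 0 2]

/-- The action of `a_i` on the words, for a transposition `i`. -/
def aInt (i : S3) : Matrix (Fin 12) (Fin 12) ℤ :=
  if i 2 = 2 then aTable₀₁ else if i 0 = 0 then aTable₁₂ else aTable₀₂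

/-- The action of `t ∈ S3` on the words, where `t` fixes the empty word. -/
def hInt (t : S3) : Matrix (Fin 12) (Fin 12) ℤ :=
  if t 2 = 2 then (if t 0 = 0 then 1 else hTable₀₁)
  else if t 0 = 0 then hTable₁₂
  else if t 1 = 1 then hTable₀₂
  else if t 0 = 1 then hTableRot else hTableRotInv

/-- Column `j` of a table is the normal form of the generator applied to the `j`-th word. This and
the next four lemmas are the defining relations for trivial χ. Over ℤ they are finite computations,
and casting transfers them to every field. -/
theorem hInt_one : hInt 1 = 1 := by decide +kernel

theorem hInt_mul : ∀ t s : S3, hInt t * hInt s = hInt (t * s) := by decide +kernel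

theorem hInt_mul_aInt : ∀ (t : S3) (x : Fin 3), hInt t * aInt (transp x) =
    (Equiv.Perm.sign t : ℤ) • (aInt (t * transp x * t⁻¹) * hInt t) := by decide +kernel

theorem aInt_sq : ∀ x : Fin 3, aInt (transp x) * aInt (transp x) = 0 := by decide +kernel

theorem aInt_quad : ∀ x y : Fin 3, x ≠ y →
    aInt (transp x) * aInt (transp y)
      + aInt (transp x * transp y * (transp x)⁻¹) * aInt (transp x)
      + aInt (transp y) * aInt (transp x * transp y * (transp x)⁻¹)
      = 1 - hInt (transp x * transp y) := by decide +kernel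

end Tables

/-! ### Universal property of induced modules -/

section InductionLift

variable {k G A W M : Type*} [Field k] [Group G] [Ring A] [Algebra k A]
  [AddCommGroup W] [Module k W] [AddCommGroup M] [Module k M] [Module A M] [IsScalarTower k A M]

theorem Ind.tmul_mul (φ : G →* A) (ρ : Representation k G W) (h : A) (g : G) (w : W) :
    Ind.tmul φ ρ (h * φ g) w = Ind.tmul φ ρ h (ρ g w) :=
  (Submodule.Quotient.eq _).2 (Submodule.subset_span ⟨h, g, w, rfl⟩)

theorem Ind.smul_tmul (φ : G →* A) (ρ : Representation k G W) (x h : A) (w : W) :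
    x • Ind.tmul φ ρ h w = Ind.tmul φ ρ (x * h) w := by
  rw [Ind.tmul, ← map_smul, TensorProduct.smul_tmul', smul_eq_mul, Ind.tmul]

theorem Ind.induction_on {φ : G →* A} {ρ : Representation k G W} {p : Ind φ ρ → Prop}
    (x : Ind φ ρ) (zero : p 0) (tmul : ∀ h w, p (Ind.tmul φ ρ h w))
    (add : ∀ x y, p x → p y → p (x + y)) : p x := by
  obtain ⟨x, rfl⟩ := (indRel φ ρ).mkQ_surjective x
  induction x with
  | zero => rwa [map_zero]
  | tmul h w => exact tmul h w
  | add x y hx hy => rw [map_add]; exact add _ _ hx hy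

/-- The map `A ⊗_{kG} W → M` induced by a `G`-equivariant linear map `W → M`. -/
def Ind.lift (φ : G →* A) (ρ : Representation k G W) (f : W →ₗ[k] M)
    (hf : ∀ g w, f (ρ g w) = φ g • f w) : Ind φ ρ →ₗ[A] M :=
  (indRel φ ρ).liftQ
    (TensorProduct.AlgebraTensorModule.lift (LinearMap.toSpanSingleton A (W →ₗ[k] M) f)) (by
      rw [indRel, Submodule.span_le]
      rintro _ ⟨h, g, w, rfl⟩
      simp [hf, mul_smul])

@[simp]
theorem Ind.lift_tmul (φ : G →* A) (ρ : Representation k G W) (f : W →ₗ[k] M)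
    (hf : ∀ g w, f (ρ g w) = φ g • f w) (h : A) (w : W) :
    Ind.lift φ ρ f hf (Ind.tmul φ ρ h w) = h • f w := by
  simp [Ind.lift, Ind.tmul]

end InductionLift

/-! ### Modules induced from a character -/

section CharacterInduction

variable {k A M : Type*} [Field k] [Ring A] [Algebra k A]
  [AddCommGroup M] [Module k M] [Module A M] [IsScalarTower k A M]

/-- The sum `∑ χ(t)⁻¹ φ(t)` over `S3`, six times the idempotent of the character `χ`. -/
def charSum (φ : S3 →* A) (χ : S3 →* kˣ) : A := ∑ t : S3, (χ t⁻¹ : k) • φ t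

theorem mul_charSum (φ : S3 →* A) (χ : S3 →* kˣ) (g : S3) :
    φ g * charSum φ χ = (χ g : k) • charSum φ χ := by
  rw [charSum, Finset.mul_sum, Finset.smul_sum]
  refine Fintype.sum_equiv (Equiv.mulLeft g) _ _ fun t => ?_
  have h : χ t⁻¹ = χ g * χ (g * t)⁻¹ := by rw [mul_comm, ← map_mul]; congr 1; group
  rw [Equiv.coe_mulLeft, mul_smul_comm, smul_smul, ← Units.val_mul, ← h, map_mul]

theorem charSum_smul_of_forall (φ : S3 →* A) (χ : S3 →* kˣ) {x : M}
    (hx : ∀ t, φ t • x = (χ t : k) • x) : charSum φ χ • x = (6 : k) • x := by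
  have h : ∀ t : S3, ((χ t⁻¹ : k) • φ t) • x = x := fun t => by
    rw [smul_assoc, hx, smul_smul, ← Units.val_mul, ← map_mul]
    simp
  rw [charSum, Finset.sum_smul, Finset.sum_congr rfl fun t _ => h t]
  simp [Fintype.card_perm, Nat.factorial, ← Nat.cast_smul_eq_nsmul k]

/-- Shows that the induced module is cyclic, generated by 1⊗1; a submodule containing 1⊗1 is
therefore everything. -/
theorem Ind.tmul_eq_smul (φ : S3 →* A) (χ : S3 →* kˣ) (h : A) (w : k) :
    Ind.tmul φ (charRep χ) h w = (w • h) • Ind.tmul φ (charRep χ) 1 1 := by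
  rw [Ind.smul_tmul, mul_one, Ind.tmul, Ind.tmul, TensorProduct.smul_tmul]
  simp

theorem smul_tmul_one_one (φ : S3 →* A) (χ : S3 →* kˣ) (t : S3) :
    φ t • Ind.tmul φ (charRep χ) 1 1 = (χ t : k) • Ind.tmul φ (charRep χ) 1 1 := by
  have h : charRep χ t 1 = (χ t : k) := by simp [charRep]
  rw [Ind.smul_tmul, mul_one, ← one_mul (φ t), Ind.tmul_mul, h, Ind.tmul_eq_smul, smul_assoc,
    one_smul]

/-- Modules induced from a character are projective. -/
theorem projective_ind_char [CharZero k] (φ : S3 →* A) (χ : S3 →* kˣ) :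
    Module.Projective A (Ind φ (charRep χ)) := by
  -- With `e = charSum / 6`, the map `h ⊗ w ↦ w h e` embeds the induced module in `A`. The map `x ↦
  -- x • (1 ⊗ 1)` retracts it, because `e` fixes the χ-eigenvector 1⊗1.
  refine Module.Projective.of_split (M := A)
    (Ind.lift φ (charRep χ) (LinearMap.toSpanSingleton k A ((6 : k)⁻¹ • charSum φ χ))
      fun g w => ?_)
    (LinearMap.toSpanSingleton A _ (Ind.tmul φ (charRep χ) 1 1)) ?_
  · simp [charRep, mul_charSum, smul_smul]
    ring_nf
  · refine LinearMap.ext fun x => ?_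
    induction x using Ind.induction_on with
    | zero => simp
    | add x y hx hy => rw [map_add, hx, hy, map_add]
    | tmul h w =>
      rw [LinearMap.comp_apply, Ind.lift_tmul, LinearMap.id_apply, Ind.tmul_eq_smul φ χ h w]
      rw [LinearMap.toSpanSingleton_apply, LinearMap.toSpanSingleton_apply, smul_eq_mul, mul_smul,
        smul_assoc w, smul_assoc _ (charSum φ χ),
        charSum_smul_of_forall φ χ (smul_tmul_one_one φ χ), smul_smul (6 : k)⁻¹,
        inv_mul_cancel₀ (by norm_num), one_smul, smul_assoc, ← smul_comm w h]

end CharacterInduction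

/-! ### Essential extensions of simple modules -/

section Modules

variable {A P M : Type*} [Ring A] [AddCommGroup P] [Module A P] [AddCommGroup M] [Module A M]

/-- An essential extension of a simple module is indecomposable. -/
theorem isIndecomposableModule_of_essential [IsSimpleModule A M] {f : P →ₗ[A] M}
    (hf : Function.Surjective f) (hN : ∀ N : Submodule A P, N ≠ ⊤ → N.map f ≠ ⊤) :
    IsIndecomposableModule A P := by
  have : Nontrivial M := IsSimpleModule.nontrivial A M
  refine ⟨hf.nontrivial, fun U V hUV => ?_⟩
  have hsup : U.map f ⊔ V.map f = ⊤ := by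
    rw [← Submodule.map_sup, hUV.sup_eq_top, Submodule.map_top, LinearMap.range_eq_top.2 hf]
  -- By simplicity, one of the two summands already maps onto `M`, and essentiality makes that
  -- summand the whole module.
  rcases eq_bot_or_eq_top (U.map f) with h | h
  · rw [h, bot_sup_eq] at hsup
    have hV : V = ⊤ := by_contra fun hV => hN V hV hsup
    left
    simpa [hV] using hUV.inf_eq_bot
  · have hU : U = ⊤ := by_contra fun hU => hN U hU h
    right
    simpa [hU] using hUV.inf_eq_bot

end Modules

theorem exists_transp (i : Transp) : ∃ x : Fin 3, transp x = i.1 := by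
  obtain ⟨_, x, y, hxy, rfl⟩ := i
  revert x y
  decide

theorem transp_isSwap (x : Fin 3) : (transp x).IsSwap := by
  fin_cases x
  · exact ⟨0, 1, by decide, rfl⟩
  · exact ⟨1, 2, by decide, rfl⟩
  · exact ⟨0, 2, by decide, rfl⟩

/-! ### The twelve-dimensional model -/

section Model

variable {k : Type*} [Field k]

variable (k) in
/-- The matrix over `k` of an integer matrix. -/
def castMatrix : Matrix (Fin 12) (Fin 12) ℤ →+* Matrix (Fin 12) (Fin 12) k :=
  (Int.castRingHom k).mapMatrix

theorem castMatrix_zsmul (n : ℤ) (B : Matrix (Fin 12) (Fin 12) ℤ) :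
    castMatrix k (n • B) = (n : k) • castMatrix k B := by
  rw [map_zsmul, Int.cast_smul_eq_zsmul]

/-- The matrices of the generators on the model of `I_χ`. -/
def genMatrix (χ : S3 →* kˣ) : Gen → Matrix (Fin 12) (Fin 12) k
  | Gen.H t => (χ t : k) • castMatrix k (hInt t)
  | Gen.a i => castMatrix k (aInt i.1)

/-- The action of `𝒜_1` on the model of `I_χ`. -/
def modelHom (χ : S3 →* kˣ) : Alg k 1 →ₐ[k] Matrix (Fin 12) (Fin 12) k :=
  RingQuot.liftAlgHom k ⟨FreeAlgebra.lift k (genMatrix χ), by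
    intro x y h
    cases h with
    | H_one => simp [freeH, genMatrix, hInt_one]
    | H_mul t s =>
      simp [freeH, genMatrix, ← hInt_mul, smul_smul, mul_comm]
    | H_a t i =>
      obtain ⟨x, hx⟩ := exists_transp i
      have h := congrArg (castMatrix k) (hInt_mul_aInt t x)
      rw [castMatrix_zsmul, map_mul, map_mul, hx] at h
      simp only [freeH, freeA, genMatrix, Transp.conj, map_mul, map_smul, FreeAlgebra.lift_ι_apply,
        smul_mul_assoc, mul_smul_comm, h]
      rw [smul_comm]
    | a_sq i =>
      obtain ⟨x, hx⟩ := exists_transp i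
      have h := congrArg (castMatrix k) (aInt_sq x)
      rw [map_mul, map_zero, hx] at h
      simp only [freeA, genMatrix, map_mul, FreeAlgebra.lift_ι_apply, h, map_zero]
    -- The twist by χ does not disturb this relation: transpositions are conjugate involutions, so
    -- `χ (i * j) = 1`.
    | a_quad i j hij =>
      obtain ⟨x, hx⟩ := exists_transp i
      obtain ⟨y, hy⟩ := exists_transp j
      have hxy : x ≠ y := by
        rintro rfl
        exact hij (Subtype.ext (hx.symm.trans hy))
      have h := congrArg (castMatrix k) (aInt_quad x y hxy)
      simp only [map_add, map_mul, map_sub, map_one, hx, hy] at h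
      simp only [freeA, freeH, genMatrix, map_mul (FreeAlgebra.lift k _), map_add, map_sub, map_one,
        one_smul, FreeAlgebra.lift_ι_apply, char_transp_mul, Units.val_one, Transp.conj, h]⟩

theorem modelHom_H (χ : S3 →* kˣ) (t : S3) :
    modelHom χ (Alg.H k 1 t) = (χ t : k) • castMatrix k (hInt t) := by
  change RingQuot.liftAlgHom k _ (RingQuot.mkAlgHom k _ _) = _
  rw [RingQuot.liftAlgHom_mkAlgHom_apply]
  simp [freeH, genMatrix]

theorem modelHom_a (χ : S3 →* kˣ) (i : Transp) :
    modelHom χ (Alg.a k 1 i) = castMatrix k (aInt i.1) := by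
  change RingQuot.liftAlgHom k _ (RingQuot.mkAlgHom k _ _) = _
  rw [RingQuot.liftAlgHom_mkAlgHom_apply]
  simp [freeA, genMatrix]

/-- The model of `I_χ`: the space with basis the words
`1, a, b, c, ab, bc, ba, ac, aba, abc, bac, abac`. -/
def Model (_χ : S3 →* kˣ) : Type _ := Fin 12 → k

instance (χ : S3 →* kˣ) : AddCommGroup (Model χ) := inferInstanceAs (AddCommGroup (Fin 12 → k))

instance (χ : S3 →* kˣ) : Module k (Model χ) := inferInstanceAs (Module k (Fin 12 → k))

instance (χ : S3 →* kˣ) : Module (Alg k 1) (Model χ) :=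
  Module.compHom (Fin 12 → k)
    ((Matrix.toLinAlgEquiv' (R := k) (n := Fin 12)).toAlgHom.comp (modelHom χ)).toRingHom

/-- The identification of the model with `k¹²`. -/
def Model.of (χ : S3 →* kˣ) : (Fin 12 → k) ≃ₗ[k] Model χ := LinearEquiv.refl k _

theorem Model.smul_of (χ : S3 →* kˣ) (h : Alg k 1) (x : Fin 12 → k) :
    h • Model.of χ x = Model.of χ ((modelHom χ h).mulVec x) := rfl

instance (χ : S3 →* kˣ) : IsScalarTower k (Alg k 1) (Model χ) where
  smul_assoc c h x := by
    obtain ⟨x, rfl⟩ := (Model.of χ).surjective x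
    rw [Model.smul_of, Model.smul_of, map_smul, Matrix.smul_mulVec, map_smul]

end Model

/-! ### Rewriting rules in the algebra -/

section Relations

variable (k : Type*) [Field k]

/-- The generators `a_(01)`, `a_(12)`, `a_(02)`. -/
def genA (x : Fin 3) : Alg k 1 := Alg.a k 1 ⟨transp x, transp_isSwap x⟩

theorem Alg.H_mul_a (t : S3) (i : Transp) : Alg.H k 1 t * Alg.a k 1 i =
    ((Equiv.Perm.sign t : ℤ) : k) • (Alg.a k 1 (Transp.conj t i) * Alg.H k 1 t) := by
  have h := RingQuot.mkAlgHom_rel k (Rel.H_a (lam := (1 : k)) t i)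
  rw [map_mul, map_smul, map_mul] at h
  exact h

theorem Alg.a_sq (i : Transp) : Alg.a k 1 i * Alg.a k 1 i = 0 := by
  have h := RingQuot.mkAlgHom_rel k (Rel.a_sq (lam := (1 : k)) i)
  rw [map_mul, map_zero] at h
  exact h

theorem Alg.a_quad (i j : Transp) (hij : i ≠ j) :
    Alg.a k 1 i * Alg.a k 1 j + Alg.a k 1 (Transp.conj i.1 j) * Alg.a k 1 i
      + Alg.a k 1 j * Alg.a k 1 (Transp.conj i.1 j) = 1 - Alg.H k 1 (i.1 * j.1) := by
  have h := RingQuot.mkAlgHom_rel k (Rel.a_quad (lam := (1 : k)) i j hij)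
  rw [one_smul, map_add, map_add, map_mul, map_mul, map_mul, map_sub, map_one] at h
  exact h

theorem genA_sq (x : Fin 3) : genA k x * genA k x = 0 := Alg.a_sq k _

theorem H_mul_genA (t : S3) (x y : Fin 3) (h : t * transp x * t⁻¹ = transp y) :
    Alg.H k 1 t * genA k x = ((Equiv.Perm.sign t : ℤ) : k) • (genA k y * Alg.H k 1 t) := by
  have hy : Transp.conj t ⟨transp x, transp_isSwap x⟩ = ⟨transp y, transp_isSwap y⟩ :=
    Subtype.ext h
  rw [genA, Alg.H_mul_a, hy, genA]

theorem genA_quad (x y z : Fin 3) (hxy : transp x ≠ transp y)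
    (h : transp x * transp y * (transp x)⁻¹ = transp z) :
    genA k x * genA k y + genA k z * genA k x + genA k y * genA k z =
      1 - Alg.H k 1 (transp x * transp y) := by
  have hz : Transp.conj (transp x) ⟨transp y, transp_isSwap y⟩ = ⟨transp z, transp_isSwap z⟩ :=
    Subtype.ext h
  have := Alg.a_quad k ⟨transp x, transp_isSwap x⟩ ⟨transp y, transp_isSwap y⟩
    fun e => hxy (congrArg Subtype.val e)
  rw [hz] at this
  exact this

/-- The three-cycle `(02)(01)`. -/
def rot : S3 := transp 2 * transp 0

/-- The quadratic relation for the pair (`c`, `a`), solved for `ca`. With its companion for `cb` it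
is a rewriting rule after which `c` survives only as the last letter of a word. -/
theorem genA_two_mul_zero : genA k 2 * genA k 0 =
    1 - Alg.H k 1 rot - genA k 0 * genA k 1 - genA k 1 * genA k 2 := by
  have := genA_quad k 2 0 1 (by decide) (by decide)
  rw [rot, ← this]; abel

theorem genA_two_mul_one : genA k 2 * genA k 1 =
    1 - Alg.H k 1 rot⁻¹ - genA k 1 * genA k 0 - genA k 0 * genA k 2 := by
  have := genA_quad k 2 1 0 (by decide) (by decide)
  rw [show rot⁻¹ = transp 2 * transp 1 by decide, ← this]; abel

theorem sign_rot : Equiv.Perm.sign rot = 1 := by decide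

theorem H_rot_mul_genA (x y : Fin 3) (h : rot * transp x * rot⁻¹ = transp y) :
    Alg.H k 1 rot * genA k x = genA k y * Alg.H k 1 rot := by
  rw [H_mul_genA k rot x y h, sign_rot]; simp

theorem H_rot_inv_mul_genA (x y : Fin 3) (h : rot⁻¹ * transp x * rot = transp y) :
    Alg.H k 1 rot⁻¹ * genA k x = genA k y * Alg.H k 1 rot⁻¹ := by
  rw [H_mul_genA k rot⁻¹ x y (by rwa [inv_inv]), map_inv, sign_rot]; simp

/-- Resolves the overlap of the rule for `ca` with `a² = 0`: expanding `(ca)a = 0` and then `b(ca)`,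
the two terms `b H_rot` cancel. With this rule the words in `a` and `b` reduce to `1, a, b, ab, ba,
aba`. -/
theorem genA_braid : genA k 1 * genA k 0 * genA k 1 =
    genA k 0 * genA k 1 * genA k 0 - genA k 0 + genA k 1 := by
  have h : genA k 2 * genA k 0 * genA k 0 = 0 := by rw [mul_assoc, genA_sq, mul_zero]
  have h₁ : genA k 1 * genA k 2 * genA k 0 =
      genA k 1 - genA k 1 * Alg.H k 1 rot - genA k 1 * genA k 0 * genA k 1 := by
    rw [mul_assoc, genA_two_mul_zero]
    simp only [mul_sub, mul_one, ← mul_assoc, genA_sq, zero_mul, sub_zero]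
  rw [genA_two_mul_zero, sub_mul, sub_mul, sub_mul, one_mul,
    H_rot_mul_genA k 0 1 (by decide), h₁] at h
  rw [← sub_eq_zero, ← h]
  abel

end Relations

/-! ### Normal forms of words applied to a vector -/

section Words

variable {k M : Type*} [Field k] [AddCommGroup M] [Module (Alg k 1) M]

theorem genA_smul_self (x : Fin 3) (m : M) : genA k x • genA k x • m = 0 := by
  rw [← mul_smul, genA_sq, zero_smul]

theorem genA_two_smul_zero (m : M) : genA k 2 • genA k 0 • m =
    m - Alg.H k 1 rot • m - genA k 0 • genA k 1 • m - genA k 1 • genA k 2 • m := by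
  rw [← mul_smul, genA_two_mul_zero]
  simp only [sub_smul, mul_smul, one_smul]

theorem genA_two_smul_one (m : M) : genA k 2 • genA k 1 • m =
    m - Alg.H k 1 rot⁻¹ • m - genA k 1 • genA k 0 • m - genA k 0 • genA k 2 • m := by
  rw [← mul_smul, genA_two_mul_one]
  simp only [sub_smul, mul_smul, one_smul]

theorem genA_braid_smul (m : M) : genA k 1 • genA k 0 • genA k 1 • m =
    genA k 0 • genA k 1 • genA k 0 • m - genA k 0 • m + genA k 1 • m := by
  rw [← mul_smul, ← mul_smul, genA_braid]
  simp only [sub_smul, add_smul, mul_smul]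

theorem H_rot_smul_genA (x y : Fin 3) (h : rot * transp x * rot⁻¹ = transp y) (m : M) :
    Alg.H k 1 rot • genA k x • m = genA k y • Alg.H k 1 rot • m := by
  rw [← mul_smul, H_rot_mul_genA k x y h, mul_smul]

theorem H_rot_inv_smul_genA (x y : Fin 3) (h : rot⁻¹ * transp x * rot = transp y) (m : M) :
    Alg.H k 1 rot⁻¹ • genA k x • m = genA k y • Alg.H k 1 rot⁻¹ • m := by
  rw [← mul_smul, H_rot_inv_mul_genA k x y h, mul_smul]

variable (k) in
/-- The words `1, a, b, c, ab, bc, ba, ac, aba, abc, bac, abac` applied to a vector. -/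
def wordVec (v : M) : Fin 12 → M :=
  ![v, genA k 0 • v, genA k 1 • v, genA k 2 • v,
    genA k 0 • genA k 1 • v, genA k 1 • genA k 2 • v,
    genA k 1 • genA k 0 • v, genA k 0 • genA k 2 • v,
    genA k 0 • genA k 1 • genA k 0 • v, genA k 0 • genA k 1 • genA k 2 • v,
    genA k 1 • genA k 0 • genA k 2 • v, genA k 0 • genA k 1 • genA k 0 • genA k 2 • v]

/-- The rewriting rules bring every letter times a word back to the words. The only group elements
they create are `rot` and its inverse, which pass the letters without sign and fix `v`. All
coefficients are then integers, so an additive subgroup suffices. -/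
theorem genA_smul_wordVec_mem (v : M) (h₁ : Alg.H k 1 rot • v = v) (h₂ : Alg.H k 1 rot⁻¹ • v = v)
    (S : AddSubgroup M) (hS : ∀ j, wordVec k v j ∈ S) (x : Fin 3) (j : Fin 12) :
    genA k x • wordVec k v j ∈ S := by
  have w := hS
  simp only [wordVec, Fin.forall_fin_succ, Matrix.cons_val_zero, Matrix.cons_val_succ,
    IsEmpty.forall_iff, and_true] at w
  obtain ⟨w₀, w₁, w₂, w₃, w₄, w₅, w₆, w₇, w₈, w₉, w₁₀, w₁₁⟩ := w
  have e₀ := fun m : M => H_rot_smul_genA (k := k) 0 1 (by decide) m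
  have e₁ := fun m : M => H_rot_smul_genA (k := k) 1 2 (by decide) m
  have e₂ := fun m : M => H_rot_smul_genA (k := k) 2 0 (by decide) m
  have f₀ := fun m : M => H_rot_inv_smul_genA (k := k) 0 2 (by decide) m
  have f₂ := fun m : M => H_rot_inv_smul_genA (k := k) 2 1 (by decide) m
  revert x j
  simp only [wordVec, Fin.forall_fin_succ, Matrix.cons_val_zero, Matrix.cons_val_succ,
    IsEmpty.forall_iff, and_true, Fin.succ_zero_eq_one, Fin.succ_one_eq_two,
    genA_smul_self, genA_two_smul_zero, genA_two_smul_one, genA_braid_smul, e₀, e₁, e₂, f₀, f₂,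
    h₁, h₂, smul_sub, smul_zero, sub_zero]
  and_intros <;>
  repeat' first
    | assumption
    | exact S.zero_mem
    | apply S.sub_mem
    | apply S.add_mem

end Words

/-! ### The span of the words is a submodule -/

section Span

variable {k M : Type*} [Field k] [AddCommGroup M] [Module k M] [Module (Alg k 1) M]
  [IsScalarTower k (Alg k 1) M]

theorem Alg.induction_on {p : Alg k 1 → Prop} (h : Alg k 1)
    (algebraMap : ∀ c : k, p (algebraMap k (Alg k 1) c)) (H : ∀ t, p (Alg.H k 1 t))
    (a : ∀ x, p (genA k x)) (mul : ∀ x y, p x → p y → p (x * y))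
    (add : ∀ x y, p x → p y → p (x + y)) : p h := by
  obtain ⟨h, rfl⟩ := RingQuot.mkAlgHom_surjective k (Rel k 1) h
  induction h using FreeAlgebra.induction with
  | grade0 c => rw [AlgHom.commutes]; exact algebraMap c
  | grade1 g =>
    cases g with
    | H t => exact H t
    | a i =>
      obtain ⟨x, hx⟩ := exists_transp i
      have := a x
      rwa [genA, show (⟨transp x, transp_isSwap x⟩ : Transp) = i from Subtype.ext hx] at this
  | mul x y hx hy => rw [map_mul]; exact mul _ _ hx hy
  | add x y hx hy => rw [map_add]; exact add _ _ hx hy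

theorem exists_transp_conj : ∀ (t : S3) (x : Fin 3), ∃ y, t * transp x * t⁻¹ = transp y := by
  decide

theorem char_rot (χ : S3 →* kˣ) : χ rot = 1 :=
  char_transp_mul χ ⟨_, transp_isSwap 2⟩ ⟨_, transp_isSwap 0⟩

/-- The words applied to an eigenvector of `S3` span a submodule. -/
theorem smul_mem_span_wordVec (χ : S3 →* kˣ) {v : M} (hv : ∀ t, Alg.H k 1 t • v = (χ t : k) • v)
    (h : Alg k 1) : ∀ m ∈ Submodule.span k (Set.range (wordVec k v)),
      h • m ∈ Submodule.span k (Set.range (wordVec k v)) := by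
  set S := Submodule.span k (Set.range (wordVec k v)) with hS
  have hw : ∀ j, wordVec k v j ∈ S := fun j => Submodule.subset_span ⟨j, rfl⟩
  have hv₀ : v ∈ S := hw 0
  have ha : ∀ x, ∀ m ∈ S, genA k x • m ∈ S := by
    intro x m hm
    induction hm using Submodule.span_induction with
    | mem m hm =>
      obtain ⟨j, rfl⟩ := hm
      exact genA_smul_wordVec_mem v (by rw [hv, char_rot]; simp)
        (by rw [hv, map_inv, char_rot]; simp) S.toAddSubgroup hw x j
    | zero => rw [smul_zero]; exact S.zero_mem
    | add m n _ _ hm hn => rw [smul_add]; exact S.add_mem hm hn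
    | smul c m _ hm => rw [smul_comm]; exact S.smul_mem c hm
  induction h using Alg.induction_on with
  | algebraMap c => intro m hm; rw [algebraMap_smul]; exact S.smul_mem c hm
  | a x => exact ha x
  | mul x y hx hy => intro m hm; rw [mul_smul]; exact hx _ (hy _ hm)
  | add x y hx hy => intro m hm; rw [add_smul]; exact S.add_mem (hx _ hm) (hy _ hm)
  | H t =>
    -- Group elements pass a letter up to sign, conjugating it. Hence stability under all `H_t`
    -- propagates from `v` to each word, letter by letter.
    have step : ∀ (x : Fin 3) (m : M), (∀ t, Alg.H k 1 t • m ∈ S) →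
        ∀ t, Alg.H k 1 t • genA k x • m ∈ S := by
      intro x m hm t
      obtain ⟨y, hy⟩ := exists_transp_conj t x
      rw [← mul_smul, H_mul_genA k t x y hy, smul_assoc, mul_smul]
      exact S.smul_mem _ (ha y _ (hm t))
    have base : ∀ t, Alg.H k 1 t • v ∈ S := fun t => by rw [hv]; exact S.smul_mem _ hv₀
    intro m hm
    induction hm using Submodule.span_induction with
    | mem m hm =>
      obtain ⟨j, rfl⟩ := hm
      revert j t
      rw [forall_comm]
      simp only [wordVec, Fin.forall_fin_succ, Matrix.cons_val_zero, Matrix.cons_val_succ,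
        IsEmpty.forall_iff, and_true]
      and_intros <;> repeat' first | exact base | apply step
    | zero => rw [smul_zero]; exact S.zero_mem
    | add m n _ _ hm hn => rw [smul_add]; exact S.add_mem hm hn
    | smul c m _ hm => rw [smul_comm]; exact S.smul_mem c hm

end Span

/-! ### The induced module is isomorphic to the model -/

section ModelIso

variable {k : Type*} [Field k] (χ : S3 →* kˣ)

/-- The generator of `I_χ`. -/
def indGen : IndChar (1 : k) χ := Ind.tmul (Alg.H k 1) (charRep χ) 1 1

theorem span_wordVec_indGen :
    Submodule.span k (Set.range (wordVec k (indGen χ))) = ⊤ := by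
  rw [eq_top_iff]
  rintro x -
  induction x using Ind.induction_on with
  | zero => exact Submodule.zero_mem _
  | add x y hx hy => exact Submodule.add_mem _ hx hy
  | tmul h w =>
    rw [Ind.tmul_eq_smul]
    exact smul_mem_span_wordVec χ (smul_tmul_one_one _ χ) _ _ (Submodule.subset_span ⟨0, rfl⟩)

/-- The words in the integer matrices of the `a_i`, applied to an integer vector. -/
def wordCol (v : Fin 12 → ℤ) : Fin 12 → Fin 12 → ℤ :=
  let a := (aInt (transp 0)).mulVec
  let b := (aInt (transp 1)).mulVec
  let c := (aInt (transp 2)).mulVec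
  ![v, a v, b v, c v, a (b v), b (c v), b (a v), a (c v), a (b (a v)), a (b (c v)), b (a (c v)),
    a (b (a (c v)))]

/-- This gives the linear independence of the twelve words, the lower bound on the dimension. -/
theorem wordCol_single : ∀ j, wordCol (Pi.single 0 1) j = Pi.single j 1 := by decide +kernel

/-- The vector of the model with given integer coordinates. -/
def Model.ofInt : (Fin 12 → ℤ) →+ Model χ :=
  (Model.of χ).toLinearMap.toAddMonoidHom.comp
    ((Int.castAddHom k).compLeft (Fin 12))

theorem Model.ofInt_apply (x : Fin 12 → ℤ) :
    Model.ofInt χ x = Model.of χ fun j => (x j : k) := rfl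

variable {χ} in
theorem genA_smul_ofInt (x : Fin 3) (v : Fin 12 → ℤ) :
    genA k x • Model.ofInt χ v = Model.ofInt χ ((aInt (transp x)).mulVec v) := by
  rw [Model.ofInt_apply, Model.smul_of, genA, modelHom_a, Model.ofInt_apply]
  congr 1
  ext i
  exact ((Int.castRingHom k).map_mulVec (aInt (transp x)) v i).symm

variable {χ} in
theorem H_smul_ofInt (t : S3) (v : Fin 12 → ℤ) :
    Alg.H k 1 t • Model.ofInt χ v = (χ t : k) • Model.ofInt χ ((hInt t).mulVec v) := by
  rw [Model.ofInt_apply, Model.smul_of, modelHom_H, Model.ofInt_apply, Matrix.smul_mulVec, map_smul]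
  congr 2
  ext i
  exact ((Int.castRingHom k).map_mulVec (hInt t) v i).symm

theorem wordVec_ofInt (v : Fin 12 → ℤ) (j : Fin 12) :
    wordVec k (Model.ofInt χ v) j = Model.ofInt χ (wordCol v j) := by
  revert j
  simp [Fin.forall_fin_succ, wordVec, wordCol, genA_smul_ofInt]

theorem hInt_mulVec_single : ∀ t, (hInt t).mulVec (Pi.single 0 1) = Pi.single 0 1 := by
  decide +kernel

theorem H_smul_ofInt_single (t : S3) : Alg.H k 1 t • Model.ofInt χ (Pi.single 0 1) =
    (χ t : k) • Model.ofInt χ (Pi.single 0 1) := by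
  rw [H_smul_ofInt, hInt_mulVec_single]

/-- The map from `I_χ` to the model. -/
def toModel : IndChar (1 : k) χ →ₗ[Alg k 1] Model χ :=
  Ind.lift (Alg.H k 1) (charRep χ)
    (LinearMap.toSpanSingleton k (Model χ) (Model.ofInt χ (Pi.single 0 1))) fun t w => by
      simp only [LinearMap.toSpanSingleton_apply, charRep, MonoidHom.coe_mk, OneHom.coe_mk,
        LinearMap.smul_apply, LinearMap.id_apply]
      rw [smul_comm, H_smul_ofInt_single, smul_smul, smul_eq_mul, mul_comm]

theorem toModel_indGen : toModel χ (indGen χ) = Model.ofInt χ (Pi.single 0 1) := by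
  simp [toModel, indGen]

theorem map_wordVec {M N : Type*} [AddCommGroup M] [Module (Alg k 1) M] [AddCommGroup N]
    [Module (Alg k 1) N] (f : M →ₗ[Alg k 1] N) (v : M) (j : Fin 12) :
    f (wordVec k v j) = wordVec k (f v) j := by
  revert j
  simp [Fin.forall_fin_succ, wordVec]

theorem toModel_wordVec (j : Fin 12) :
    toModel χ (wordVec k (indGen χ) j) = Model.of χ (Pi.single j 1) := by
  rw [map_wordVec, toModel_indGen, wordVec_ofInt, wordCol_single, Model.ofInt_apply]
  congr 1
  ext i
  by_cases h : i = j
  · subst h; simp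
  · simp [h]

/-- The words give a surjection from `k¹²` onto I_χ, and its composite with `toModel` is the
coordinate isomorphism. Hence both maps are bijective. -/
theorem toModel_bijective : Function.Bijective (toModel χ) := by
  let F : (Fin 12 → k) →ₗ[k] IndChar (1 : k) χ := Fintype.linearCombination k (wordVec k (indGen χ))
  have hF : Function.Surjective F := by
    rw [← LinearMap.range_eq_top, Fintype.range_linearCombination, span_wordVec_indGen]
  have hGF : ∀ x, toModel χ (F x) = Model.of χ x := by
    intro x
    have : ((toModel χ).restrictScalars k) ∘ₗ F = (Model.of χ).toLinearMap := by
      refine LinearMap.pi_ext' fun j => LinearMap.ext_ring ?_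
      simp [F, toModel_wordVec]
    exact LinearMap.congr_fun this x
  refine ⟨fun x y hxy => ?_, fun m => ?_⟩
  · obtain ⟨x, rfl⟩ := hF x
    obtain ⟨y, rfl⟩ := hF y
    rw [hGF, hGF] at hxy
    rw [(Model.of χ).injective hxy]
  · obtain ⟨x, rfl⟩ := (Model.of χ).surjective m
    exact ⟨F x, hGF x⟩

/-- The induced module `I_χ` is isomorphic to its model. -/
def modelEquiv : IndChar (1 : k) χ ≃ₗ[Alg k 1] Model χ :=
  LinearEquiv.ofBijective (toModel χ) (toModel_bijective χ)

theorem modelEquiv_indGen : modelEquiv χ (indGen χ) = Model.ofInt χ (Pi.single 0 1) :=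
  toModel_indGen χ

theorem finrank_indChar : Module.finrank k (IndChar (1 : k) χ) = 12 := by
  rw [((modelEquiv χ).restrictScalars k).finrank_eq, ← (Model.of χ).finrank_eq]
  simp

end ModelIso

/-! ### The projective cover of the character -/

section Cover

variable {k : Type*} [Field k] (χ : S3 →* kˣ)

instance : IsScalarTower k (Alg k 1) (SimpleChar (1 : k) χ) where
  smul_assoc c h x := by
    obtain ⟨x, rfl⟩ := (SimpleChar.of (1 : k) χ).surjective x
    rw [SimpleChar.smul_of, SimpleChar.smul_of, map_smul, smul_mul_assoc, map_smul]

theorem H_smul_simpleChar (t : S3) (x : SimpleChar (1 : k) χ) :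
    Alg.H k 1 t • x = (χ t : k) • x := by
  obtain ⟨x, rfl⟩ := (SimpleChar.of (1 : k) χ).surjective x
  rw [SimpleChar.smul_of, Alg.char_H, ← map_smul, smul_eq_mul]

theorem genA_smul_simpleChar (x : Fin 3) (y : SimpleChar (1 : k) χ) : genA k x • y = 0 := by
  obtain ⟨y, rfl⟩ := (SimpleChar.of (1 : k) χ).surjective y
  rw [SimpleChar.smul_of, genA, Alg.char_a, zero_mul, map_zero]

instance : IsSimpleModule (Alg k 1) (SimpleChar (1 : k) χ) := by
  rw [isSimpleModule_iff_toSpanSingleton_surjective]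
  refine ⟨(SimpleChar.of (1 : k) χ).symm.toEquiv.nontrivial, fun x hx y => ?_⟩
  obtain ⟨x, rfl⟩ := (SimpleChar.of (1 : k) χ).surjective x
  obtain ⟨y, rfl⟩ := (SimpleChar.of (1 : k) χ).surjective y
  have hx' : x ≠ 0 := fun h => hx (by rw [h, map_zero])
  refine ⟨algebraMap k _ (y / x), ?_⟩
  rw [LinearMap.toSpanSingleton_apply, algebraMap_smul, ← map_smul, smul_eq_mul,
    div_mul_cancel₀ _ hx']

/-- The canonical map `I_χ → S_χ`. -/
def coverMap : IndChar (1 : k) χ →ₗ[Alg k 1] SimpleChar (1 : k) χ :=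
  Ind.lift (Alg.H k 1) (charRep χ) (SimpleChar.of (1 : k) χ).toLinearMap fun t w => by
    rw [H_smul_simpleChar, LinearEquiv.coe_coe, ← map_smul]
    simp [charRep]

theorem coverMap_tmul (h : Alg k 1) (w : k) :
    coverMap χ (Ind.tmul (Alg.H k 1) (charRep χ) h w) = h • SimpleChar.of 1 χ w :=
  Ind.lift_tmul ..

theorem coverMap_indGen : coverMap χ (indGen χ) = SimpleChar.of 1 χ 1 := by
  rw [indGen, coverMap_tmul, one_smul]

theorem coverMap_surjective : Function.Surjective (coverMap χ) := fun y => by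
  obtain ⟨y, rfl⟩ := (SimpleChar.of (1 : k) χ).surjective y
  exact ⟨Ind.tmul _ _ 1 y, by rw [coverMap_tmul, one_smul]⟩

variable (k) in
/-- The element `abac - ac` of `𝒜_1`. It maps the generator of `I_χ` to a
`χ`-eigenvector of `S3`. -/
def socleElt : Alg k 1 :=
  genA k 0 * genA k 1 * genA k 0 * genA k 2 - genA k 0 * genA k 2

/-- The action of `abac - ac` on integer vectors. -/
def socleCol (v : Fin 12 → ℤ) : Fin 12 → ℤ := wordCol v 11 - wordCol v 7

theorem socleElt_smul_ofInt (v : Fin 12 → ℤ) :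
    socleElt k • Model.ofInt χ v = Model.ofInt χ (socleCol v) := by
  rw [socleCol, map_sub, ← wordVec_ofInt, ← wordVec_ofInt, socleElt]
  simp [wordVec, sub_smul, mul_smul]

theorem socleCol_socleCol_single : socleCol (socleCol (Pi.single 0 1)) = 0 := by decide +kernel

theorem socleElt_smul_smul_indGen : socleElt k • socleElt k • indGen χ = 0 := by
  apply (modelEquiv χ).injective
  rw [map_smul, map_smul, modelEquiv_indGen, socleElt_smul_ofInt, socleElt_smul_ofInt,
    socleCol_socleCol_single, map_zero, map_zero]

theorem coverMap_socleElt_smul (x : IndChar (1 : k) χ) : coverMap χ (socleElt k • x) = 0 := by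
  rw [map_smul, socleElt, sub_smul, mul_smul, mul_smul, mul_smul, mul_smul]
  simp [genA_smul_simpleChar]

/-- The sum over the group has rank two: only the words `1` (index 0) and `abac` (index 11) survive
it. This determines the χ-isotypic part of I_χ. -/
theorem sum_hInt_mulVec_single : ∀ j : Fin 12, ∑ t, (hInt t).mulVec (Pi.single j 1) =
    (Pi.single 0 6 : Fin 12 → ℤ) j • Pi.single 0 1
      + (Pi.single 11 6 : Fin 12 → ℤ) j • socleCol (Pi.single 0 1) := by
  decide +kernel

/-- The coefficients `χ t⁻¹` cancel the twist by χ in the model, so one integer computation serves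
all χ. -/
theorem charSum_smul_ofInt (v : Fin 12 → ℤ) :
    charSum (Alg.H k 1) χ • Model.ofInt χ v = Model.ofInt χ (∑ t, (hInt t).mulVec v) := by
  rw [charSum, Finset.sum_smul, map_sum]
  refine Finset.sum_congr rfl fun t _ => ?_
  rw [smul_assoc, H_smul_ofInt, smul_smul, ← Units.val_mul, ← map_mul, inv_mul_cancel, map_one,
    Units.val_one, one_smul]

theorem exists_charSum_smul (x : IndChar (1 : k) χ) : ∃ c d : k,
    charSum (Alg.H k 1) χ • x = c • indGen χ + d • socleElt k • indGen χ := by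
  have hx : x ∈ Submodule.span k (Set.range (wordVec k (indGen χ))) := by
    rw [span_wordVec_indGen]; trivial
  induction hx using Submodule.span_induction with
  | mem x hx =>
    obtain ⟨j, rfl⟩ := hx
    refine ⟨(((Pi.single 0 6 : Fin 12 → ℤ) j : ℤ) : k),
      (((Pi.single 11 6 : Fin 12 → ℤ) j : ℤ) : k), (modelEquiv χ).injective ?_⟩
    rw [Int.cast_smul_eq_zsmul, Int.cast_smul_eq_zsmul, map_add, map_zsmul, map_zsmul, map_smul,
      map_smul, ← LinearEquiv.coe_coe, map_wordVec, LinearEquiv.coe_coe, modelEquiv_indGen,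
      wordVec_ofInt, wordCol_single, charSum_smul_ofInt, sum_hInt_mulVec_single,
      socleElt_smul_ofInt, map_add, map_zsmul, map_zsmul]
  | zero => exact ⟨0, 0, by simp⟩
  | add x y _ _ hx hy =>
    obtain ⟨c, d, h⟩ := hx
    obtain ⟨c', d', h'⟩ := hy
    exact ⟨c + c', d + d', by rw [smul_add, h, h', add_smul, add_smul]; abel⟩
  | smul r x _ hx =>
    obtain ⟨c, d, h⟩ := hx
    exact ⟨r * c, r * d, by rw [smul_comm, h, smul_add, mul_smul, mul_smul]⟩

/-- Projecting a preimage of 1 to the χ-isotypic part stays inside `N` and yields the generator up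
to a nilpotent correction, which can be inverted. -/
theorem coverMap_essential [CharZero k] (N : Submodule (Alg k 1) (IndChar (1 : k) χ))
    (hN : N ≠ ⊤) : N.map (coverMap χ) ≠ ⊤ := by
  contrapose! hN
  obtain ⟨x, hxN, hx⟩ : SimpleChar.of (1 : k) χ 1 ∈ N.map (coverMap χ) := hN ▸ Submodule.mem_top
  obtain ⟨c, d, hcd⟩ := exists_charSum_smul χ x
  -- Compare images in S_χ: `charSum` acts there as 6, and `socleElt` as 0.
  have hc : c = 6 := by
    have h := congrArg (coverMap χ) hcd
    rw [map_smul, hx, charSum_smul_of_forall _ χ fun t => H_smul_simpleChar χ t _, map_add,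
      LinearMap.map_smul_of_tower, LinearMap.map_smul_of_tower, coverMap_socleElt_smul,
      coverMap_indGen, smul_zero, add_zero, ← map_smul, ← map_smul] at h
    simpa using ((SimpleChar.of (1 : k) χ).injective h).symm
  subst hc
  have hy : (6 : k) • indGen χ + d • socleElt k • indGen χ ∈ N := hcd ▸ N.smul_mem _ hxN
  have hz : (36 : k) • indGen χ ∈ N := by
    -- On the generator, `(6 - d z)(6 + d z) = 36 - d² z²` and `z²` vanishes.
    have h := N.smul_mem (algebraMap k (Alg k 1) 6 - d • socleElt k) hy
    rw [sub_smul, algebraMap_smul, smul_assoc, smul_add (socleElt k),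
      smul_comm (socleElt k) (6 : k), smul_comm (socleElt k) d, socleElt_smul_smul_indGen] at h
    generalize socleElt k • indGen χ = p at h
    convert h using 1
    simp only [smul_add, smul_smul, smul_zero, add_zero, mul_comm d 6, add_sub_cancel_right]
    norm_num
  have hv : indGen χ ∈ N := by
    have h := N.smul_mem (algebraMap k (Alg k 1) (36 : k)⁻¹) hz
    rwa [algebraMap_smul, smul_smul, inv_mul_cancel₀ (by norm_num), one_smul] at h
  rw [eq_top_iff]
  rintro y -
  induction y using Ind.induction_on with
  | zero => exact N.zero_mem
  | add y z hy hz => exact N.add_mem hy hz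
  | tmul h w => rw [Ind.tmul_eq_smul]; exact N.smul_mem _ hv

end Cover

/-! ### Recognising a representation from explicit vectors -/

section Decomposition

variable {k M : Type*} [Field k] [AddCommGroup M] [Module k M]

/-- A twelve-dimensional representation of `S3` spanned by two invariant vectors, two vectors on
which `S3` acts by the sign and four pairs on which `S3` acts by the standard matrices. -/
theorem nonempty_equiv_of_families (σ : Representation k S3 M) (hM : Module.finrank k M = 12)
    (u s : Fin 2 → M) (p : Fin 4 → Fin 2 → M) (hu : ∀ t i, σ t (u i) = u i)
    (hs : ∀ t i, σ t (s i) = ((Equiv.Perm.sign t : ℤ) : k) • s i)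
    (hp : ∀ t i j, σ t (p i j) = ∑ l, stMatrix k t l j • p i l)
    (hspan : ∀ S : Submodule k M, (∀ i, u i ∈ S) → (∀ i, s i ∈ S) → (∀ i j, p i j ∈ S) → S = ⊤) :
    Nonempty (σ.Equiv
      ((Representation.directSum fun _ : Fin 2 => charRep (1 : S3 →* kˣ)).prod
        ((Representation.directSum fun _ : Fin 2 => charRep (sgChar k)).prod
          (Representation.directSum fun _ : Fin 4 => stRep k)))) := by
  let Φ := (DirectSum.toModule k (Fin 2) M fun i => LinearMap.toSpanSingleton k M (u i)).coprod
    ((DirectSum.toModule k (Fin 2) M fun i => LinearMap.toSpanSingleton k M (s i)).coprod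
      (DirectSum.toModule k (Fin 4) M fun i => Fintype.linearCombination k (p i)))
  -- Both sides have dimension 2 + 2 + 4·2 = 12, so spanning is enough and linear independence need
  -- not be checked.
  have hsurj : Function.Surjective Φ := by
    rw [← LinearMap.range_eq_top]
    refine hspan _ (fun i => ⟨(DirectSum.lof k _ _ i 1, 0, 0), ?_⟩)
      (fun i => ⟨(0, DirectSum.lof k _ _ i 1, 0), ?_⟩)
      (fun i j => ⟨(0, 0, DirectSum.lof k _ _ i (Pi.single j 1)), ?_⟩) <;>
    simp [Φ]
  have hfin : Module.finrank k ((DirectSum (Fin 2) fun _ => k) × (DirectSum (Fin 2) fun _ => k) ×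
      (DirectSum (Fin 4) fun _ => (Fin 2 → k))) = Module.finrank k M := by
    rw [hM]
    simp [Module.finrank_prod, Module.finrank_directSum]
  -- `finrank` is 0 in infinite dimension, so the value 12 forces finiteness.
  have : FiniteDimensional k M := Module.finite_of_finrank_pos (by omega)
  have hinj : Function.Injective Φ :=
    (LinearMap.injective_iff_surjective_of_finrank_eq_finrank hfin).2 hsurj
  refine ⟨(Representation.Equiv.mk (LinearEquiv.ofBijective Φ ⟨hinj, hsurj⟩) fun t => ?_).symm⟩
  change Φ ∘ₗ _ = _ ∘ₗ Φ
  ext i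
  · simp [Φ, charRep, hu]
  · simp [Φ, charRep, sgChar, hs]
  · rename_i j
    simp [Φ, stRep, hp, Fintype.linearCombination_apply]

end Decomposition

/-! ### Explicit decomposition of the model over S3 -/

section Families

/-- The invariant vectors `1` and `abac - ac`. -/
def trivInt : Fin 2 → Fin 12 → ℤ :=
  ![![1, 0, 0, 0, 0, 0, 0, 0, 0, 0, 0, 0], ![0, 0, 0, 0, 0, 0, 0, -1, 0, 0, 0, 1]]

/-- Vectors on which `S3` acts by the sign. -/
def signInt : Fin 2 → Fin 12 → ℤ :=
  ![![0, 1, 1, 1, 0, 0, 0, 0, 0, 0, 0, 0], ![0, 0, 1, 2, 0, 0, 0, 0, 1, -1, -1, 0]]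

/-- Bases of copies of the standard representation. -/
def stInt : Fin 4 → Fin 2 → Fin 12 → ℤ :=
  ![![![0, 1, 1, -2, 0, 0, 0, 0, 0, 0, 0, 0], ![0, -1, 2, -1, 0, 0, 0, 0, 0, 0, 0, 0]],
    ![![0, 0, 0, 0, 0, -1, 0, 1, 0, 0, 0, 0], ![0, 0, 0, 0, 1, 0, 1, 1, 0, 0, 0, 0]],
    ![![0, 0, 0, 0, 1, 1, -1, -1, 0, 0, 0, 0], ![0, 0, 0, 0, 0, 1, -1, 0, 0, 0, 0, 0]],
    ![![0, 0, -2, 2, 0, 0, 0, 0, -2, -1, -1, 0], ![0, 0, -1, 1, 0, 0, 0, 0, -1, -2, 1, 0]]]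

/-- Bases of copies of the standard representation twisted by the sign. -/
def stTwistInt (i : Fin 4) : Fin 2 → Fin 12 → ℤ :=
  ![stInt i 0 - 2 • stInt i 1, 2 • stInt i 0 - stInt i 1]

/-- Three times the coordinates with respect to `trivInt`. -/
def trivCoord : Fin 2 → Fin 12 → ℤ :=
  ![![3, 0, 0, 0, 0, 0, 0, 0, 0, 0, 0, 0], ![0, 0, 0, 0, 0, 0, 0, 0, 0, 0, 0, 3]]

/-- Three times the coordinates with respect to `signInt`. -/
def signCoord : Fin 2 → Fin 12 → ℤ :=
  ![![0, 1, 1, 1, 0, 0, 0, 0, -1, 1, 1, 0], ![0, 0, 0, 0, 0, 0, 0, 0, 1, -1, -1, 0]]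

/-- Three times the coordinates with respect to `stInt`. -/
def stCoord : Fin 4 → Fin 2 → Fin 12 → ℤ :=
  ![![![0, 1, 0, -1, 0, 0, 0, 0, 0, -1, -1, 0], ![0, -1, 1, 0, 0, 0, 0, 0, -1, 0, 0, 0]],
    ![![0, 0, 0, 0, 1, -2, -2, 1, 0, 0, 0, 1], ![0, 0, 0, 0, 1, 1, 1, 1, 0, 0, 0, 1]],
    ![![0, 0, 0, 0, 2, -1, -1, -1, 0, 0, 0, -1], ![0, 0, 0, 0, -1, 2, -1, 2, 0, 0, 0, 2]],
    ![![0, 0, 0, 0, 0, 0, 0, 0, -1, 0, -1, 0], ![0, 0, 0, 0, 0, 0, 0, 0, 0, -1, 1, 0]]]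

theorem hInt_mulVec_trivInt : ∀ t i, (hInt t).mulVec (trivInt i) = trivInt i := by
  decide +kernel

theorem hInt_mulVec_signInt : ∀ t i, (hInt t).mulVec (signInt i) =
    (Equiv.Perm.sign t : ℤ) • signInt i := by
  decide +kernel

theorem hInt_mulVec_stInt : ∀ t i j, (hInt t).mulVec (stInt i j) =
    ∑ l, stMatrix ℤ t l j • stInt i l := by
  decide +kernel

/-- An instance of W_st ⊗ W_sg ≅ W_st: the basis `p, q` becomes `p - 2q, 2p - q`, a change of
determinant 3. -/
theorem hInt_mulVec_stTwistInt : ∀ t i j,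
    (Equiv.Perm.sign t : ℤ) • (hInt t).mulVec (stTwistInt i j) =
    ∑ l, stMatrix ℤ t l j • stTwistInt i l := by
  decide +kernel

/-- Serves to show that the families span. The inverse change of basis has denominators dividing 3,
which are cleared to stay over ℤ. -/
theorem three_smul_single : ∀ j : Fin 12, (3 : ℤ) • (Pi.single j 1 : Fin 12 → ℤ) =
    ∑ i, trivCoord i j • trivInt i + ∑ i, signCoord i j • signInt i
      + ∑ i, ∑ l, stCoord i l j • stInt i l := by
  decide +kernel

theorem three_smul_stInt : ∀ i, (3 : ℤ) • stInt i 0 = (2 : ℤ) • stTwistInt i 1 - stTwistInt i 0 ∧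
    (3 : ℤ) • stInt i 1 = stTwistInt i 1 - (2 : ℤ) • stTwistInt i 0 := by
  decide +kernel

variable {k : Type*} [Field k]

theorem stMatrix_cast (t : S3) (i j : Fin 2) : ((stMatrix ℤ t i j : ℤ) : k) = stMatrix k t i j := by
  rw [← stMatrix_map k]; rfl

theorem ofInt_zsmul (χ : S3 →* kˣ) (n : ℤ) (v : Fin 12 → ℤ) :
    Model.ofInt χ (n • v) = (n : k) • Model.ofInt χ v := by
  rw [map_zsmul, Int.cast_smul_eq_zsmul]

theorem resRep_ofInt (χ : S3 →* kˣ) (t : S3) (v : Fin 12 → ℤ) :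
    resRep k (Model χ) (Alg.H k 1) t (Model.ofInt χ v) =
      (χ t : k) • Model.ofInt χ ((hInt t).mulVec v) :=
  H_smul_ofInt t v

variable [CharZero k]

theorem mem_of_three_smul_mem {M : Type*} [AddCommGroup M] [Module k M] {S : Submodule k M} {x : M}
    (h : ((3 : ℤ) : k) • x ∈ S) : x ∈ S :=
  (S.smul_mem_iff (by norm_num)).1 h

theorem eq_top_of_families (χ : S3 →* kˣ) (S : Submodule k (Model χ))
    (hu : ∀ i, Model.ofInt χ (trivInt i) ∈ S) (hs : ∀ i, Model.ofInt χ (signInt i) ∈ S)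
    (hp : ∀ i j, Model.ofInt χ (stInt i j) ∈ S) : S = ⊤ := by
  have he : ∀ j, Model.ofInt χ (Pi.single j 1) ∈ S := fun j => by
    refine mem_of_three_smul_mem ?_
    rw [← ofInt_zsmul, three_smul_single]
    simp only [map_add, map_sum, ofInt_zsmul]
    exact S.add_mem (S.add_mem (S.sum_mem fun i _ => S.smul_mem _ (hu i))
      (S.sum_mem fun i _ => S.smul_mem _ (hs i)))
      (S.sum_mem fun i _ => S.sum_mem fun l _ => S.smul_mem _ (hp i l))
  rw [eq_top_iff]
  rintro m -
  obtain ⟨x, rfl⟩ := (Model.of χ).surjective m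
  have hx : Model.of χ x = ∑ j, x j • Model.ofInt χ (Pi.single j 1) := by
    simp only [Model.ofInt_apply, ← map_smul, ← map_sum]
    congr 1
    ext i
    simp [Finset.sum_apply, Pi.single_apply]
  rw [hx]
  exact S.sum_mem fun j _ => S.smul_mem _ (he j)

theorem nonempty_equiv_model (χ : S3 →* kˣ) (hχ : χ = 1 ∨ χ = sgChar k) :
    Nonempty ((resRep k (Model χ) (Alg.H k 1)).Equiv
      ((Representation.directSum fun _ : Fin 2 => charRep (1 : S3 →* kˣ)).prod
        ((Representation.directSum fun _ : Fin 2 => charRep (sgChar k)).prod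
          (Representation.directSum fun _ : Fin 4 => stRep k)))) := by
  have hdim : Module.finrank k (Model χ) = 12 := by
    rw [← (Model.of χ).finrank_eq]; simp
  rcases hχ with rfl | rfl
  · refine nonempty_equiv_of_families _ hdim (fun i => Model.ofInt _ (trivInt i))
      (fun i => Model.ofInt _ (signInt i)) (fun i j => Model.ofInt _ (stInt i j)) (fun t i => ?_)
      (fun t i => ?_) (fun t i j => ?_) (eq_top_of_families _)
    · rw [resRep_ofInt, hInt_mulVec_trivInt]; simp
    · rw [resRep_ofInt, hInt_mulVec_signInt, ofInt_zsmul]; simp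
    · rw [resRep_ofInt, hInt_mulVec_stInt, map_sum]
      simp only [ofInt_zsmul, stMatrix_cast, MonoidHom.one_apply, Units.val_one, one_smul]
  · have hsg : ∀ t, (sgChar k t : k) = ((Equiv.Perm.sign t : ℤ) : k) := fun t => rfl
    -- The sign twist makes the `signInt` vectors invariant and the `trivInt` vectors alternating,
    -- and the standard pairs are replaced by their twisted bases.
    refine nonempty_equiv_of_families _ hdim (fun i => Model.ofInt _ (signInt i))
      (fun i => Model.ofInt _ (trivInt i)) (fun i j => Model.ofInt _ (stTwistInt i j))
      (fun t i => ?_) (fun t i => ?_) (fun t i j => ?_)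
      (fun S hs hu hp => eq_top_of_families _ S hu hs fun i => ?_)
    · rw [resRep_ofInt, hInt_mulVec_signInt, ofInt_zsmul, hsg, smul_smul, ← Int.cast_mul,
        ← Units.val_mul, Int.units_mul_self]
      simp
    · rw [resRep_ofInt, hInt_mulVec_trivInt, hsg]
    · rw [resRep_ofInt, hsg, ← ofInt_zsmul, hInt_mulVec_stTwistInt, map_sum]
      simp only [ofInt_zsmul, stMatrix_cast]
    · have h := three_smul_stInt i
      refine Fin.forall_fin_two.2 ⟨mem_of_three_smul_mem ?_, mem_of_three_smul_mem ?_⟩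
      · rw [← ofInt_zsmul, h.1, map_sub, ofInt_zsmul]
        exact S.sub_mem (S.smul_mem _ (hp i 1)) (hp i 0)
      · rw [← ofInt_zsmul, h.2, map_sub, ofInt_zsmul]
        exact S.sub_mem (hp i 1) (S.smul_mem _ (hp i 0))

/-- The isomorphism of `I_χ` with its model as representations of `S3`. -/
def resRepModelEquiv (χ : S3 →* kˣ) : (resRep k (IndChar (1 : k) χ) (Alg.H k 1)).Equiv
    (resRep k (Model χ) (Alg.H k 1)) :=
  Representation.Equiv.mk ((modelEquiv χ).restrictScalars k) fun t =>
    LinearMap.ext fun x => (modelEquiv χ).map_smul (Alg.H k 1 t) x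

end Families

end PointedS3

end

theorem mainTheorem3 {k : Type*} [Field k] [IsAlgClosed k] [CharZero k]
    (χ : PointedS3.S3 →* kˣ) (hχ : χ = 1 ∨ χ = PointedS3.sgChar k) :
    PointedS3.IsIndecomposableModule (PointedS3.Alg k 1) (PointedS3.IndChar (1 : k) χ) ∧
    (∃ π : PointedS3.IndChar (1 : k) χ →ₗ[PointedS3.Alg k 1] PointedS3.SimpleChar (1 : k) χ,
      (∀ (h : PointedS3.Alg k 1) (w : k),
        π (PointedS3.Ind.tmul (PointedS3.Alg.H k 1) (PointedS3.charRep χ) h w) =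
          h • PointedS3.SimpleChar.of 1 χ w) ∧
      PointedS3.IsProjectiveCover π) ∧
    Module.finrank k (PointedS3.IndChar (1 : k) χ) = 12 ∧
    Nonempty ((PointedS3.resRep k (PointedS3.IndChar (1 : k) χ) (PointedS3.Alg.H k 1)).Equiv
      ((Representation.directSum fun _ : Fin 2 => PointedS3.charRep (1 : PointedS3.S3 →* kˣ)).prod
        ((Representation.directSum fun _ : Fin 2 => PointedS3.charRep (PointedS3.sgChar k)).prod
          (Representation.directSum fun _ : Fin 4 => PointedS3.stRep k)))) :=
  ⟨PointedS3.isIndecomposableModule_of_essential (PointedS3.coverMap_surjective χ)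
      (PointedS3.coverMap_essential χ),
    ⟨PointedS3.coverMap χ, PointedS3.coverMap_tmul χ, PointedS3.projective_ind_char _ χ,
      PointedS3.coverMap_surjective χ, PointedS3.coverMap_essential χ⟩,
    PointedS3.finrank_indChar χ,
    (PointedS3.nonempty_equiv_model χ hχ).map (PointedS3.resRepModelEquiv χ).trans⟩
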